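/- A holographic graph model for six parties $A,B,C,D,E,F$ is a finite undirected graph with nonnegative edge weights in which some vertices (the boundary vertices) are each labelled by one of $A,\dots,F$ or by the purifier $O$. For a set $I$ of parties, let $S(I)$ be the minimum, over all vertex sets $W$ that contain every boundary vertex with label in $I$ and no other boundary vertex, of the total weight of the edges joining $W$ to its complement. We write $S(ABC)$ for $S(\{A,B,C\})$, etc. Both of the following inequalities hold for every holographic graph model for six parties (they are valid entropy inequalities on graphs): (1) $$\begin{aligned} &2S(ABC)+2S(ABD)+S(ABE)+S(ABF)+S(ACD)+2S(ACE)+S(ACF)+S(ADE)\\ &+S(ADF)+2S(BCD)+S(CDE)+S(CEF)\\ &\ge 2S(AB)+S(AC)+S(AD)+S(AE)+S(AF)+S(BC)+S(BD)+S(CD)+S(CE)+S(CF)\\ &\quad+S(DE)+2S(ABCD)+S(ABCE)+S(ABDF)+S(ACDE)+S(ACEF); \end{aligned}$$ (2) $$\begin{aligned} &S(ABC)+S(ABD)+S(ABE)+S(ABF)+S(ACD)+S(ACF)+S(ADE)+S(AEF)\\ &+S(BCF)+S(BDF)+S(CDF)+S(ABCE)+S(BCEF)+S(CDEF)\\ &\ge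 2S(AB)+S(AC)+S(AD)+S(AE)+S(BF)+S(CD)+S(CF)+S(DF)+S(EF)\\ &\quad+S(BCE)+S(ABCF)+S(ABDE)+S(BCDF)+S(ABCEF)+S(ACDEF). \end{aligned}$$ Moreover, each of the two inequalities admits a contraction map. Here, for an inequality $\sum_{l=1}^M\alpha_l S(I_l)\ge\sum_{r=1}^{N}S(J_r)$ with distinct $I_l$, in which every right-hand term with coefficient $2$ is written twice, a contraction map is a map $f:\{0,1\}^M\to\{0,1\}^N$ such that - for each $k\in\{A,\dots,F,O\}$, $f$ sends the bitstring whose $l$-th bit is $1$ iff $k\in I_l$ to the bitstring whose $r$-th bit is $1$ iff $k\in J_r$ (so for $k=O$ the zero string is sent to the zero string), and - $\sum_{r=1}^N|f(x)_r-f(x')_r|\le\sum_{l=1}^M\alpha_l|x_l-x'_l|$ for all $x,x'\in\{0,1\}^M$. -/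

import Mathlib

universe u

/-- A (static) holographic graph model for `n` parties: a finite undirected graph with nonnegative
edge weights, some of whose vertices are boundary vertices.  A boundary vertex carries a label in
`Fin (n + 1)`: the labels `0, …, n - 1` are the parties and the last label is the purifier.
Vertices with label `none` are bulk vertices. -/
structure HoloGraph (n : ℕ) (V : Type*) where
  /-- the underlying graph -/
  graph : SimpleGraph V
  /-- the edge weights (only the values on edges of `graph` are used) -/
  weight : Sym2 V → ℝ
  weight_nonneg : ∀ e ∈ graph.edgeSet, 0 ≤ weight e
  /-- the boundary labelling -/
  label : V → Option (Fin (n + 1))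

/-- The party (or purifier) `k` belongs to the subsystem `I ⊆ {0, …, n - 1}`; the purifier belongs
to none. -/
def OccursIn {n : ℕ} (k : Fin (n + 1)) (I : Finset (Fin n)) : Prop :=
  ∃ i ∈ I, i.castSucc = k

instance {n : ℕ} (k : Fin (n + 1)) (I : Finset (Fin n)) : Decidable (OccursIn k I) :=
  inferInstanceAs (Decidable (∃ i ∈ I, i.castSucc = k))

namespace HoloGraph

variable {n : ℕ} {V : Type*} [Fintype V]

/-- The edge `e` joins `W` to its complement. -/
def Crosses (W : Finset V) (e : Sym2 V) : Prop :=
  ∃ u v, e = s(u, v) ∧ u ∈ W ∧ v ∉ W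

open Classical in
/-- Total weight of the edges joining `W` to its complement. -/
noncomputable def cutWeight (G : HoloGraph n V) (W : Finset V) : ℝ :=
  ∑ e ∈ G.graph.edgeFinset with Crosses W e, G.weight e

/-- `W` is a cut for the subsystem `I`: the boundary vertices in `W` are exactly those whose label
belongs to `I`. -/
def IsCut (G : HoloGraph n V) (I : Finset (Fin n)) (W : Finset V) : Prop :=
  ∀ v k, G.label v = some k → (v ∈ W ↔ OccursIn k I)

open Classical in
/-- All cuts for the subsystem `I`. -/
noncomputable def cuts (G : HoloGraph n V) (I : Finset (Fin n)) : Finset (Finset V) :=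
  {W | G.IsCut I W}

theorem mem_cuts (G : HoloGraph n V) (I : Finset (Fin n)) (W : Finset V) :
    W ∈ G.cuts I ↔ G.IsCut I W := by
  simp [cuts]

theorem cuts_nonempty (G : HoloGraph n V) (I : Finset (Fin n)) : (G.cuts I).Nonempty := by
  classical
  refine ⟨Finset.univ.filter (fun v => ∃ k, G.label v = some k ∧ OccursIn k I), ?_⟩
  refine (G.mem_cuts I _).2 fun v k hk => ?_
  simp [hk]

/-- The entropy `S(I)`: the minimal weight of a cut for `I`. -/
noncomputable def entropy (G : HoloGraph n V) (I : Finset (Fin n)) : ℝ :=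
  (G.cuts I).inf' (G.cuts_nonempty I) G.cutWeight

end HoloGraph

/-- A candidate `n`-party entropy inequality `∑ α_l S(I_l) ≥ ∑ β_r S(J_r)`, given by the lists of
the pairs `(α_l, I_l)` and `(β_r, J_r)`. -/
structure EntropyInequality (n : ℕ) where
  lhs : List (ℕ × Finset (Fin n))
  rhs : List (ℕ × Finset (Fin n))

/-- The Hamming distance on bitstrings of length `m` with weights `γ`. -/
def weightedHamming {m : ℕ} (γ : Fin m → ℕ) (x x' : Fin m → Bool) : ℕ :=
  ∑ i, γ i * (if x i = x' i then 0 else 1)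

namespace EntropyInequality

variable {n : ℕ}

/-- The inequality holds on every holographic graph model. -/
def ValidOnGraphs (Q : EntropyInequality n) : Prop :=
  ∀ (V : Type u) [Fintype V] (G : HoloGraph n V),
    (Q.rhs.map fun t => (t.1 : ℝ) * G.entropy t.2).sum ≤
      (Q.lhs.map fun t => (t.1 : ℝ) * G.entropy t.2).sum

/-- The subsystems of the right-hand side, each repeated as often as its coefficient says. -/
def expandedRhs (Q : EntropyInequality n) : List (Finset (Fin n)) :=
  Q.rhs.flatMap fun t => List.replicate t.1 t.2

/-- The occurrence bitstring of the party (or purifier) `k` on the left-hand side. -/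
def lhsOccurrence (Q : EntropyInequality n) (k : Fin (n + 1)) : Fin Q.lhs.length → Bool :=
  fun l => decide (OccursIn k (Q.lhs.get l).2)

/-- The occurrence bitstring of the party (or purifier) `k` on the expanded right-hand side. -/
def rhsOccurrence (Q : EntropyInequality n) (k : Fin (n + 1)) : Fin Q.expandedRhs.length → Bool :=
  fun r => decide (OccursIn k (Q.expandedRhs.get r))

/-- `f` is a contraction map for the inequality: it sends the occurrence bitstrings of the left-hand
side to those of the expanded right-hand side (homology property), and it does not increase
distances, where the left-hand side distance is weighted by the coefficients `α_l` and the distance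
on the expanded right-hand side is the plain Hamming distance. -/
def IsContractionMap (Q : EntropyInequality n)
    (f : (Fin Q.lhs.length → Bool) → (Fin Q.expandedRhs.length → Bool)) : Prop :=
  (∀ k, f (Q.lhsOccurrence k) = Q.rhsOccurrence k) ∧
  ∀ x x', weightedHamming (fun _ => 1) (f x) (f x') ≤
    weightedHamming (fun l => (Q.lhs.get l).1) x x'

end EntropyInequality

namespace SixParty

/-- The six parties. -/
abbrev A : Fin 6 := 0
abbrev B : Fin 6 := 1
abbrev C : Fin 6 := 2
abbrev D : Fin 6 := 3
abbrev E : Fin 6 := 4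
abbrev F : Fin 6 := 5

/-- The first six-party inequality. -/
def ineqOne : EntropyInequality 6 where
  lhs := [(2, {A, B, C}), (2, {A, B, D}), (1, {A, B, E}), (1, {A, B, F}), (1, {A, C, D}),
    (2, {A, C, E}), (1, {A, C, F}), (1, {A, D, E}), (1, {A, D, F}), (2, {B, C, D}),
    (1, {C, D, E}), (1, {C, E, F})]
  rhs := [(2, {A, B}), (1, {A, C}), (1, {A, D}), (1, {A, E}), (1, {A, F}), (1, {B, C}),
    (1, {B, D}), (1, {C, D}), (1, {C, E}), (1, {C, F}), (1, {D, E}), (2, {A, B, C, D}),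
    (1, {A, B, C, E}), (1, {A, B, D, F}), (1, {A, C, D, E}), (1, {A, C, E, F})]

/-- The second six-party inequality. -/
def ineqTwo : EntropyInequality 6 where
  lhs := [(1, {A, B, C}), (1, {A, B, D}), (1, {A, B, E}), (1, {A, B, F}), (1, {A, C, D}),
    (1, {A, C, F}), (1, {A, D, E}), (1, {A, E, F}), (1, {B, C, F}), (1, {B, D, F}),
    (1, {C, D, F}), (1, {A, B, C, E}), (1, {B, C, E, F}), (1, {C, D, E, F})]
  rhs := [(2, {A, B}), (1, {A, C}), (1, {A, D}), (1, {A, E}), (1, {B, F}), (1, {C, D}),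
    (1, {C, F}), (1, {D, F}), (1, {E, F}), (1, {B, C, E}), (1, {A, B, C, F}),
    (1, {A, B, D, E}), (1, {B, C, D, F}), (1, {A, B, C, E, F}), (1, {A, C, D, E, F})]

end SixParty

/-! ### Cuts and entropies on a graph. -/

namespace HoloGraph

/-! A contraction map `f` proves its inequality by cutting and regluing. Minimal cuts for the
left-hand subsystems give each vertex a bitstring; the vertices where bit `r` of its image under `f`
is 1 form a region. The occurrence condition makes this region a cut for `J_r`, and contraction,
applied to the two ends of each edge, bounds the total weight of the new cuts by that of the old
ones (`IsContractionMap.validOnGraphs`).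

It remains to exhibit the two maps. By the triangle inequality, contraction need only be checked on
hypercube edges (`weightedHamming_le_of_update`). Each output bit is stored as its truth table, a
natural number with one binary digit per input, so that a few bitwise operations treat all edges of
one direction at once (`isContractionMap_of_certifies`). The kernel runs this test on explicit
tables, compressed as decision trees. The decoder needs no correctness proof, since the test is
applied to the numbers it returns. -/

theorem crosses_mk_iff {V : Type*} (W : Finset V) (u v : V) :
    Crosses W s(u, v) ↔ ¬(u ∈ W ↔ v ∈ W) := by
  constructor
  · rintro ⟨a, b, hab, ha, hb⟩
    rcases Sym2.eq_iff.1 hab with ⟨rfl, rfl⟩ | ⟨rfl, rfl⟩ <;> tauto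
  · intro h
    by_cases hu : u ∈ W
    · exact ⟨u, v, rfl, hu, by tauto⟩
    · exact ⟨v, u, Sym2.eq_swap, by tauto, hu⟩

variable {n : ℕ} {V : Type*} [Fintype V]

open Classical in
-- The index set no longer depends on `W`, so sums over cuts and over edges can be interchanged.
theorem cutWeight_eq_sum_ite (G : HoloGraph n V) (W : Finset V) :
    G.cutWeight W = ∑ e ∈ G.graph.edgeFinset, G.weight e * (if Crosses W e then 1 else 0) := by
  simp [cutWeight, Finset.sum_filter]

theorem entropy_le_cutWeight (G : HoloGraph n V) {I : Finset (Fin n)} {W : Finset V}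
    (hW : G.IsCut I W) : G.entropy I ≤ G.cutWeight W :=
  Finset.inf'_le _ ((G.mem_cuts I W).2 hW)

theorem exists_isCut_entropy_eq (G : HoloGraph n V) (I : Finset (Fin n)) :
    ∃ W, G.IsCut I W ∧ G.entropy I = G.cutWeight W := by
  obtain ⟨W, hW, h⟩ := Finset.exists_mem_eq_inf' (G.cuts_nonempty I) G.cutWeight
  exact ⟨W, (G.mem_cuts I W).1 hW, h⟩

end HoloGraph

/-! ### From contraction maps to entropy inequalities. -/

namespace EntropyInequality

variable {n : ℕ}

theorem sum_expandedRhs (Q : EntropyInequality n) (g : Finset (Fin n) → ℝ) :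
    (Q.rhs.map fun t => (t.1 : ℝ) * g t.2).sum = ∑ r, g (Q.expandedRhs.get r) := by
  have h : ∑ r, g (Q.expandedRhs.get r) = (Q.expandedRhs.map g).sum :=
    Fin.sum_univ_fun_getElem Q.expandedRhs g
  rw [h, expandedRhs]
  induction Q.rhs with
  | nil => simp
  | cons t ts ih => simp [ih]

theorem sum_lhs (Q : EntropyInequality n) (g : Finset (Fin n) → ℝ) :
    (Q.lhs.map fun t => (t.1 : ℝ) * g t.2).sum =
      ∑ l, ((Q.lhs.get l).1 : ℝ) * g (Q.lhs.get l).2 :=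
  (Fin.sum_univ_fun_getElem Q.lhs fun t => (t.1 : ℝ) * g t.2).symm

/-- An inequality that admits a contraction map is valid on graphs: the regions formed from the
minimal cuts of the left-hand side according to the contraction map are cuts for the right-hand
side. -/
theorem IsContractionMap.validOnGraphs {Q : EntropyInequality n}
    {f : (Fin Q.lhs.length → Bool) → (Fin Q.expandedRhs.length → Bool)}
    (hf : Q.IsContractionMap f) : ValidOnGraphs.{u} Q := by
  classical
  intro V _ G
  choose W hW hS using G.exists_isCut_entropy_eq
  let x : V → Fin Q.lhs.length → Bool := fun v l => decide (v ∈ W (Q.lhs.get l).2)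
  let U : Fin Q.expandedRhs.length → Finset V := fun r => {v | f (x v) r = true}
  have hU : ∀ r, G.IsCut (Q.expandedRhs.get r) (U r) := by
    intro r v k hk
    -- Cut conditions fix the bitstring of a boundary vertex, and `hf.1` then fixes its image.
    have hx : x v = Q.lhsOccurrence k := by
      funext l
      exact decide_eq_decide.2 (hW _ v k hk)
    simp only [U, Finset.mem_filter, Finset.mem_univ, true_and, hx, hf.1 k, rhsOccurrence,
      decide_eq_true_eq]
  rw [sum_expandedRhs, sum_lhs]
  calc ∑ r, G.entropy (Q.expandedRhs.get r) ≤ ∑ r, G.cutWeight (U r) :=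
        Finset.sum_le_sum fun r _ => G.entropy_le_cutWeight (hU r)
    _ = ∑ e ∈ G.graph.edgeFinset,
          G.weight e * ∑ r, (if HoloGraph.Crosses (U r) e then (1 : ℝ) else 0) := by
        simp_rw [G.cutWeight_eq_sum_ite, Finset.mul_sum]
        exact Finset.sum_comm
    _ ≤ ∑ e ∈ G.graph.edgeFinset, G.weight e * ∑ l, ((Q.lhs.get l).1 : ℝ) *
          (if HoloGraph.Crosses (W (Q.lhs.get l).2) e then (1 : ℝ) else 0) := by
        refine Finset.sum_le_sum fun e he => mul_le_mul_of_nonneg_left ?_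
          (G.weight_nonneg e (SimpleGraph.mem_edgeFinset.1 he))
        induction e with | _ u v => ?_
        -- The edge crosses a cut exactly when the corresponding bits at `u` and `v` differ, so both
        -- sides are Hamming distances.
        have h := hf.2 (x u) (x v)
        unfold weightedHamming at h
        have h' := (Nat.cast_le (α := ℝ)).2 h
        push_cast at h'
        convert h' using 3 with r _ l _
        · simp only [HoloGraph.crosses_mk_iff, U, Finset.mem_filter, Finset.mem_univ, true_and,
            one_mul, ← Bool.eq_iff_iff, ite_not]
        · simp only [HoloGraph.crosses_mk_iff, x, decide_eq_decide, ite_not]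
    _ = ∑ l, ((Q.lhs.get l).1 : ℝ) * G.entropy (Q.lhs.get l).2 := by
        simp_rw [hS, G.cutWeight_eq_sum_ite, Finset.mul_sum]
        rw [Finset.sum_comm]
        exact Finset.sum_congr rfl fun l _ => Finset.sum_congr rfl fun e _ => by ring

end EntropyInequality

/-! ### Contraction along hypercube edges. -/

section Hamming

variable {m n : ℕ}

theorem weightedHamming_self (γ : Fin m → ℕ) (x : Fin m → Bool) : weightedHamming γ x x = 0 := by
  simp [weightedHamming]

theorem weightedHamming_comm (γ : Fin m → ℕ) (x y : Fin m → Bool) :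
    weightedHamming γ x y = weightedHamming γ y x := by
  simp [weightedHamming, eq_comm]

theorem weightedHamming_triangle (γ : Fin m → ℕ) (x y z : Fin m → Bool) :
    weightedHamming γ x z ≤ weightedHamming γ x y + weightedHamming γ y z := by
  rw [weightedHamming, weightedHamming, weightedHamming, ← Finset.sum_add_distrib]
  refine Finset.sum_le_sum fun i _ => ?_
  rw [← mul_add]
  refine Nat.mul_le_mul_left _ ?_
  cases x i <;> cases y i <;> cases z i <;> simp

/-- The contraction property only has to be checked along the edges of the hypercube. -/
theorem weightedHamming_le_of_update (γ : Fin m → ℕ) (δ : Fin n → ℕ)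
    (f : (Fin m → Bool) → (Fin n → Bool))
    (h : ∀ x l, x l = false →
      weightedHamming δ (f x) (f (Function.update x l true)) ≤ γ l)
    (x x' : Fin m → Bool) : weightedHamming δ (f x) (f x') ≤ weightedHamming γ x x' := by
  -- The hypothesis only raises a bit; symmetry of the distance covers lowering it.
  have flip : ∀ x l b, weightedHamming δ (f x) (f (Function.update x l b)) ≤
      γ l * (if x l = b then 0 else 1) := by
    intro x l b
    by_cases hb : x l = b
    · subst hb
      simp [weightedHamming_self]
    · rw [if_neg hb, mul_one]
      cases b
      · have := h (Function.update x l false) l (by simp)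
        rw [Function.update_idem, weightedHamming_comm] at this
        rwa [Function.update_eq_self_iff.2 (by simpa using hb)] at this
      · exact h x l (by simpa using hb)
  -- Walk from `x` to `x'` one coordinate at a time; `s` contains every coordinate that may still
  -- differ.
  suffices H : ∀ (s : Finset (Fin m)) (x : Fin m → Bool), (∀ i ∉ s, x i = x' i) →
      weightedHamming δ (f x) (f x') ≤ ∑ i ∈ s, γ i * (if x i = x' i then 0 else 1) from
    H Finset.univ x (by simp)
  intro s
  induction s using Finset.induction_on with
  | empty =>
    intro x hx
    rw [funext fun i => hx i (by simp), weightedHamming_self]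
    simp
  | insert a s ha ih =>
    intro x hx
    rw [Finset.sum_insert ha]
    refine (weightedHamming_triangle δ _ (f (Function.update x a (x' a))) _).trans
      (add_le_add (flip x a (x' a)) ((ih _ fun i hi => ?_).trans_eq ?_))
    · by_cases hia : i = a
      · subst hia
        simp
      · rw [Function.update_of_ne hia]
        exact hx i (by simp [hi, hia])
    · refine Finset.sum_congr rfl fun i hi => ?_
      rw [Function.update_of_ne (ne_of_mem_of_not_mem hi ha)]

end Hamming

/-! ### Testing truth tables with bitwise arithmetic. -/

/-- Bit `i` of `countExceeds k ds` is set iff more than `k` of the numbers `ds` have bit `i` set. -/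
def countExceeds : List ℕ → ℕ → ℕ
  | [], _ => 0
  | d :: ds, 0 => d ||| countExceeds ds 0
  | d :: ds, k + 1 => (d &&& countExceeds ds k) ||| countExceeds ds (k + 1)

/-- The default 0 contributes nothing, so `n` need not be the length of `ds`. -/
theorem sum_testBit_le_of_countExceeds {i : ℕ} (ds : List ℕ) (k n : ℕ)
    (h : (countExceeds ds k).testBit i = false) :
    ∑ r : Fin n, (if (ds.getD r 0).testBit i then 1 else 0) ≤ k := by
  induction ds generalizing k n with
  | nil => simp
  | cons d ds ih =>
    cases n with
    | zero => simp
    | succ n =>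
      rw [Fin.sum_univ_succ]
      cases k with
      | zero =>
        simp only [countExceeds, Nat.testBit_or, Bool.or_eq_false_iff] at h
        simpa [h.1] using ih 0 n h.2
      | succ k =>
        simp only [countExceeds, Nat.testBit_or, Nat.testBit_and, Bool.or_eq_false_iff,
          Bool.and_eq_false_iff] at h
        have h1 := ih (k + 1) n h.2
        -- Either the head lacks bit `i`, or the tail has it at most `k` times and the head adds at
        -- most one.
        rcases h.1 with hd | hd
        · simpa [hd] using h1
        · have h2 := ih k n hd
          simp only [Fin.val_zero, List.getD_cons_zero, Fin.val_succ, List.getD_cons_succ]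
          split <;> omega

/-- The number with `2 ^ (l + 1 + j)` bits whose bit `i` is set iff bit `l` of `i` is not set. -/
def unsetMask (l : ℕ) : ℕ → ℕ
  | 0 => 2 ^ 2 ^ l - 1
  | j + 1 => unsetMask l j ||| (unsetMask l j <<< 2 ^ (l + 1 + j))

/-- One direction suffices: superfluous mask bits would only make the test stricter. -/
theorem testBit_unsetMask {l i : ℕ} (j : ℕ) (hi : i < 2 ^ (l + 1 + j)) (h : i.testBit l = false) :
    (unsetMask l j).testBit i = true := by
  induction j generalizing i with
  | zero =>
    rw [unsetMask, Nat.testBit_two_pow_sub_one, decide_eq_true_eq]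
    by_contra hl
    rw [Nat.testBit_eq_decide_div_mod_eq] at h
    have : i / 2 ^ l = 1 := by
      refine Nat.div_eq_of_lt_le (by omega) ?_
      rw [add_zero, pow_succ] at hi
      omega
    simp [this] at h
  | succ j ih =>
    rw [unsetMask, Nat.testBit_or, Nat.testBit_shiftLeft, Bool.or_eq_true, Bool.and_eq_true]
    by_cases hs : i < 2 ^ (l + 1 + j)
    · exact Or.inl (ih hs h)
    · refine Or.inr ⟨by simpa using hs, ih ?_ ?_⟩
      · rw [← add_assoc, pow_succ] at hi
        omega
      · have := Nat.testBit_two_pow_add_gt (show l < l + 1 + j by omega) (i - 2 ^ (l + 1 + j))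
        rwa [Nat.add_sub_cancel' (by omega), h, eq_comm] at this

/-- Hence shifting a truth table right by `2 ^ l` aligns each input having bit `l` unset with its
neighbour in direction `l`. -/
theorem ofBits_update_true {m : ℕ} (x : Fin m → Bool) (l : Fin m) (h : x l = false) :
    Nat.ofBits (Function.update x l true) = 2 ^ (l : ℕ) + Nat.ofBits x := by
  induction m with
  | zero => exact l.elim0
  | succ m ih =>
    rw [Nat.ofBits_succ, Nat.ofBits_succ]
    refine Fin.cases (fun h => ?_) (fun l h => ?_) l h
    · have : Function.update x 0 true ∘ Fin.succ = x ∘ Fin.succ := by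
        funext i
        simp
      simp [this, h]
      omega
    · have : Function.update x l.succ true ∘ Fin.succ =
          Function.update (x ∘ Fin.succ) l true := by
        funext i
        simp [Function.update_apply]
      rw [this, ih _ l h, Function.update_of_ne (Fin.succ_ne_zero l).symm, Fin.val_succ, pow_succ]
      ring

/-- The map of bitstrings whose output bits have the truth tables `ts`. -/
def truthTableMap (m n : ℕ) (ts : List ℕ) (x : Fin m → Bool) : Fin n → Bool :=
  fun r => (ts.getD r 0).testBit (Nat.ofBits x)

namespace EntropyInequality

variable {n : ℕ}

/-- The truth tables `ts` pass the test for a contraction map for `Q`: along every direction of the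
hypercube the number of changing output bits is at most the coefficient (this is tested in parallel
for all edges of that direction), and the occurrence bitstrings have the right images. -/
def Certifies (Q : EntropyInequality n) (ts : List ℕ) : Bool :=
  decide (∀ l : Fin Q.lhs.length, countExceeds (ts.map fun t => t ^^^ (t >>> 2 ^ (l : ℕ))) (Q.lhs.get l).1 &&&
      unsetMask l (Q.lhs.length - (l + 1)) = 0) &&
    decide (∀ k (r : Fin Q.expandedRhs.length), (ts.getD r 0).testBit (Nat.ofBits (Q.lhsOccurrence k)) = Q.rhsOccurrence k r)

theorem isContractionMap_of_certifies {Q : EntropyInequality n} {ts : List ℕ}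
    (h : Q.Certifies ts = true) : Q.IsContractionMap (truthTableMap _ _ ts) := by
  rw [Certifies, Bool.and_eq_true, decide_eq_true_eq, decide_eq_true_eq] at h
  refine ⟨fun k => funext fun r => h.2 k r, weightedHamming_le_of_update _ _ _ fun x l hl => ?_⟩
  have hbit : (Nat.ofBits x).testBit l = false := by rw [Nat.testBit_ofBits_lt _ _ l.2]; exact hl
  have hlt : Nat.ofBits x < 2 ^ ((l : ℕ) + 1 + (Q.lhs.length - (l + 1))) := by
    rw [Nat.add_sub_cancel' l.2]
    exact Nat.ofBits_lt_two_pow x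
  -- Bit `l` of `x` is unset, so the mask is 1 at position `x` and the count there cannot exceed the
  -- coefficient.
  have hcount := congrArg (Nat.testBit · (Nat.ofBits x)) (h.1 l)
  simp only [Nat.testBit_and, testBit_unsetMask _ hlt hbit, Bool.and_true, Nat.zero_testBit]
    at hcount
  refine le_of_eq_of_le ?_ (sum_testBit_le_of_countExceeds _ _ Q.expandedRhs.length hcount)
  refine Finset.sum_congr rfl fun r _ => ?_
  have hmap : (ts.map fun t => t ^^^ (t >>> 2 ^ (l : ℕ))).getD r 0 =
      (ts.getD r 0) ^^^ ((ts.getD r 0) >>> 2 ^ (l : ℕ)) := by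
    have := List.getD_map (l := ts) (n := (r : ℕ)) (d := 0) (fun t => t ^^^ (t >>> 2 ^ (l : ℕ)))
    simpa using this
  rw [hmap, Nat.testBit_xor, Nat.testBit_shiftRight, truthTableMap, truthTableMap,
    ofBits_update_true x l hl, one_mul]
  generalize (ts.getD r 0).testBit (Nat.ofBits x) = a
  generalize (ts.getD r 0).testBit (2 ^ (l : ℕ) + Nat.ofBits x) = b
  cases a <;> cases b <;> rfl

end EntropyInequality

/-! ### Forced evaluation and decision-tree encoding. -/

/-- `forceNat a k` is `k a`; the kernel evaluates `a` to a numeral before it enters `k`. -/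
def forceNat {α : Type*} (a : ℕ) (k : ℕ → α) : α :=
  match a with
  | 0 => k 0
  | b + 1 => k (b + 1)

theorem forceNat_eq {α : Type*} (a : ℕ) (k : ℕ → α) : forceNat a k = k a := by
  cases a <;> rfl

/-- `forceList as k` is `k as`; the kernel evaluates the entries of `as` before they enter `k`. -/
def forceList {α : Type*} : List ℕ → (List ℕ → α) → α
  | [], k => k []
  | a :: as, k => forceNat a fun b => forceList as fun bs => k (b :: bs)

theorem forceList_eq {α : Type*} (as : List ℕ) (k : List ℕ → α) : forceList as k = k as := by
  induction as generalizing k with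
  | nil => rfl
  | cons a as ih => rw [forceList, forceNat_eq, ih]

/-- Truth table of the variable `v` among `m` variables. -/
def varTable (m v : ℕ) : ℕ :=
  -- For `v < m` the division is exact: the quotient alternates blocks of `2 ^ v` ones and zeros,
  -- ones lowest, and the product shifts it by one block.
  (2 ^ 2 ^ m - 1) / (2 ^ 2 ^ v + 1) * 2 ^ 2 ^ v

/-- Runs a decision tree in postfix notation on a stack of truth tables in `m ≤ 14` variables. The
hexadecimal digits of `code`, from the lowest on, are `14` for false, `15` for true, and `v` for
a branching on variable `v` between the two preceding trees. -/
def runTree (m : ℕ) : ℕ → ℕ → List ℕ → ℕ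
  | 0, _, s => s.headD 0
  | fuel + 1, code, s =>
    forceNat (code / 16) fun rest =>
      forceNat (code % 16) fun v =>
        bif Nat.beq v 14 then runTree m fuel rest (0 :: s)
        else bif Nat.beq v 15 then runTree m fuel rest ((2 ^ 2 ^ m - 1) :: s)
        else match s with
          | b :: a :: s' =>
            -- Bitwise selection: `b`, the later tree, where variable `v` is 1, and `a` elsewhere.
            forceNat (a ^^^ ((a ^^^ b) &&& varTable m v)) fun t => runTree m fuel rest (t :: s')
          | _ => 0

/-- The truth table of the decision tree with `fuel` digits given by `code`. -/
def treeTable (m : ℕ) (p : ℕ × ℕ) : ℕ :=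
  runTree m p.1 p.2 []

/-! ### Certificates for the two inequalities. -/

namespace SixParty

/-- Truth tables of the output bits of a contraction map for `ineqOne`. -/
def tablesOne : List ℕ :=
  List.map (treeTable 12) [(151, 0x013925ab784f6fee4e6effffae5b784f6feeeff8fa47fbe2f5febe2f57feef5be92a4e6e78efffe8fa47fe2e6e7eff29a4e78efffbe8fa47fe7effe47be98235aeff5eaef35eaefee3feeee),
    (77, 0x03ae925be1f4e6e7ef1f6b478feeeffe1be2f54f7feeee1e2569be43e78aefee7e8e3faefeeee),
    (267, 0x0456f7e1ab32e9fe89fefeebf23eafe9f3eafe1e23e678e9eabfeeeee597816b2aefefe236befafbfeae6beffeee6123f8fabeff37fbef78fabeffebe23faef73faefeee56321a89b4f7feefb47fee947ef7fef4f978fbfe8bfeefe419aeb7f8fee7f8fabeffe7819aebfefe9a1fbefe1abeffee1ae829b4f7feef9e4f7fe4792bfeefeeeee),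
    (23, 0x1478b0592aefeff9fefeeee),
    (89, 0x2579ef13490e6e8eabfeefe9e48fb6aef0fafef6ea08ebfefe9eb6ef34fea6ef4fe03e46e7e9eab18effeeeee),
    (161, 0x90eae125b347f8fe78fee4e67e8efeeee3847256bfebefe65befbfee56e2fbeff5627fbfef7befffe2e4e567befeeea013be82f54f7fee472f5feeeeee831f56f7b04feefff01f47befeee1470f3feeee),
    (203, 0x90832e4e56e71abfeeaebefeea5b167efe24f6f7effe1e24e7feee7514b23eafe3afefe6b23eafe3afefe3fa2ebfefb24f6fef342ef62efaef2a4f6feef41e6b23afeffee3fa1e2e6bfeeff8e1ae5be374e6eff2467efeee2347effee245e67b3faefeeeeee),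
    (25, 0x15e6ebe9f02e3e47e8eafeeee),
    (189, 0x2e90513ab67ef4e78efeeea4f6f78befebfe7ebfe67bf3eafefb4f7ef3ea4f7efe3ea4f178feeee13a856eff4567ebfe7fe7feee8564afe7afeaefff4af567ebfe7fe7fee4a35bf67ef7fe76beffef568e7bfef73bfef8ebfe3e76beffeee),
    (35, 0x1e58eb36e7a04e9effeeaf6e704e9effeee),
    (83, 0x67eb13e5a28e90f4fee80e4e9effee2950f438afeffe3e4afeeef3e5a91e0f8e24fef2e8e10e4effeee),
    (27, 0x0e3ea765e1fbeff14856effeeee),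
    (123, 0x40f19f78fbefbe8f3aef56aefafeafe579f6be3faefe92bf368afefe6fafefe9fe9f03f7a18fb56feef65fbfeeff1be82f3f567faefffae3f562f7feeee),
    (169, 0x924f560fb713f8faefef3fa71fe8eff1b03f78aefff8f37aeff7eaeff0f7ebe3faefff0f18fb3a47f56fee562f7feeef47faf52f6fee56ae2f7feeef456f7fbf3eafe72f6b3eafeff3eafe56be23faef73faefeee),
    (169, 0x90f231a54f67f8fbeff8e47efff6b5fe478aef5feff45f78aefeff5f47eae18ef6beff18ef6b7afeeff5f138eae47effee5f21f6b047f3eafe3e7afee3e7afeeff013bef4b7e8eafefbe78faeff3e4a76bfeefeee),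
    (345, 0x901f35baef4a278feeef6aef2f78feaefa26b47feeff4786beffeeef5be4278aefeee6e2a78feef7aefe247a86beffefae6beff6beff7846beffa6beffeee81f5b36f7aeffae26f7ef4e6f7ef634f27faef7ef7fae24fe4eff2467b3aefafefffff31f75a246befeeeb6fe2f46fe6efae2f46bfeefaef567a1fe2b1fe4fe14fbefe1fe1fe1fe1f863fa5be2f7fe0247befbfeffff5b37a04feeffae704feefffae356f7b04feefff047befeee),
    (149, 0x41f268fbf03f5f7f9faef3579afeffffff72fb103f56f9afefff5f63eafeff519a360f2f8efb0f28efeef6f0e2b38fe8efee2f6f30befea08effe2f6fbf09f3eafe3eafe3ea0189fefffe),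
    (183, 0x150f923abf46f7e8ef867feeff68ab4f7fee4f7fbfeabf47ef7fefbf8e47eaeffb38faf46f7fe67feef683ae4f7fee473aefef3e7aefafeef69bfe03f47f8fa2befbfefffe5f6f047b3982eafefeaf928effeebf23e9eafeebfebfe)]

/-- Truth tables of the output bits of a contraction map for `ineqTwo`. -/
def tablesTwo : List ℕ :=
  List.map (treeTable 14) [(453, 0x3d012baef5ae7c46f89eff68efeff4c687faefea78efefecaef6e89aef7afeeeae46e75e8ebecfe895becefbfcfeee7e5bece68fef68bfcfeebfcf89fee45e7aebec628fee8efeee21ae4b56f897cefeffe765f8cfee895eceff5fcfe5c68fe89effee57ce68bfefb89effe68ebcefcfeee4e567e89bcefeeeeee1ae02fbf57c46f89eff68efeff4c67e8fe789feefecf6e89fee25fbf467f8cfeecf789eff8fecf678efe8fe5467fbf8cfeec89eff789bfeffb89effe67ce8bfef8ebcefcfeeee4e761be02e58e9acdefeeee289eaecedfeeee589bce0d21efaefe1e2aedefeeeeee),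
    (381, 0x2de30bf57c46f89effeffc467e8f1eafe789feeffe4b56f897ce1faefeffe7516f89eff6a8eceffae89effec685fe1e5afe9eaef589effee56ce78b1faefe1fabfef8eb1faefeee10a4e65bec789fee8efee8957bcfeceffbfcfeeebf57c46f89effeffc467e8fe789feeffe5ae467fbf8cfeec89eff789bfeffb89effe6ce78bfef8ebfeee468eaebce0f5fec7e9e05eff50f7feee086e957bcfeceffbfcfee5cbe7f6aefe6ae7fbfeeee46e79035e8eabcdfeeeee13e8aebecedefeeeee),
    (101, 0x049e5bfecd21e367e8eaebefee6e8abfeeeee12e3e6e8eaed57e9bcfeee7becefeee12e456e89aeb37ecedfe7cdefeeeeeeee),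
    (269, 0x648e1cef3a025e7becdfeeeeece205fbfdef57fbfdefde7fbfede05fbfe57fbfeee917ed2a53e80bcefcfeece0beff8ece03befffe8ece35e0beff05afbefffee8ecea105bf2e3e7edfe2e7ed3beffe2e7ed35effee05b1f32fdefeeee879ce3245ebe01adfeee1eaedefee1aebd02e45efe24e5feeeeee0e39eaed21e4e5bcefee45ecfeeeee),
    (797, 0x786bce412ad30f5feeff3ade0f5fe0f5fdefaede0f5feae2d30f5feef3de0f5fee05123fadeff3adeffaedefae23fdef3defeee0145ce23fadeff3adeffaedef2daefce3faef3aecdfedefeeae34ce25fdef5defee25de4cefcfeeeeeb62a1d30f54fcefeefce4d30f5feef053fdefeef3ade01fce4f5fe514fcef4cefee01fdce4f59efefd514fcef4cefee1f45fcef5cefeaede01fce4f5fe51f4cefeecea124d30f5feef503fdef3defee3de04f5fe45feeee412f30f5fdefde0f5fe2d30f5feef3de0f5fee5d012f3fe23feee3f01f2fe12feee40d256a31fcefefce13faef3aefeae1f63ceffe35ae16fcef6cefeee63a12f5fece2f5fef251faceffae1fcef5ae1fcefecea123f5fe35feee2f13f5fe35fee1e26aecd35effeeee6a1032d5cefcf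efde5cefcfed5c2f9efee25cefcfee2cde35effeeec250d1e3eff3e1dfeff135e0fdef05dfedefe0de35ef5feed210fe503fe3eff0315fe5efee03f12f5feeee4e68e15bec032fadeffae2f9deff2de3faefeeeaed203be5cfecefeb35cfeffc35effee35bec0f2feeeee),
    (405, 0x38b9402e5e6e7acedfeeee62ea5cdf0e1e7fee07cedfeeeecf0572eadfeeff257d1afefe1fdeff5af7dfedefa7dfeefe4e65cd29a07fefee907fafefa01e7fefe0e1e729afee9fafeeee95fcfd702eafe12afeffe02fee25ad01e7cfeecf1e7feeeea075df1ecfecdfeee5fcf7dfee5c71dfef0edfeee4e56ec29abe01e7dfeedf1e7feeed9afbe01e7fefabe01e7fefe0e1e79afbefabefeeee6e8921aed0457becfeeecf57beffbfee4ecf57beff0fbfee04ea5e7bcedfeee17de5bcfecefbfcfe5dbeceffbfcfeeeee),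
    (257, 0x30e1e257e9ced46e8bfee68eaebefeeeeea470e256e89bce1dfefeeeeed29056bec18efef8bfcfebecef6f8eff6e80fbfcfeef6e820e59b1ecefcfeeec5f09ebfeeeeb256e7e8d09ef1e9cefeeee0d7e9e5f6e8cfeec957168fee6e8efee6e857effeeee6e7e802ecd45f9ebfe59ebfeeee5c2e4df9befee9bd214fef4efeeeee),
    (69, 0xd102e4e5e6789ebecefeeee520e47e368e9eaebecfee6e89abcefeeeee6e8acfeeeee),
    (645, 0xb2e79a30e5e46dc18efef1e8fe8ecdef1dfefce68def1dfee8edef46dc18e05effe05eff1e805effe8e05ecdef1dfefcdef1dfefce68de015efff1d05effee8ede05effeec168e94a05e3dfef35dfeff3ed05effead03e5ef35effeeeee350ed49a6f8efee68e19afeefee9a0d46f8ef68efee6f8efee9a054ede68fe8ef6f8ef6f8ef4d05e6f8ef6f8efeee9256e8cd01e7a3f4efeeaf3e47efeeeeea07dc1648e35effe583f4efee435f6e8feef4351e6e8fe6f8ef6f8ef168e35effe53f6e8fee481e356ecfe6fe6fe6e1c35effe35effc1e5368fef6e8fee6835effe8e35eff6c18e435dfeffd35effee35d4f18efeeff8e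ce354dfeeffdf746c18e35eff35fee35eff358f1ecfe8cfecef85cfeecef168f35cfecefcefff35c4618efe8fe68feffffd63e47e0c18efeffe758c01e3f4effeee80e35cfee4f5cfee3e40ceffeee),
    (253, 0x716e8cd03e45e9be2afeaefee2e5a439fbefefeeeeec0ed4365829abefeeb9afeefee89fbe25afee5fafe529abefee9afbefabefeeef56e82abe349fef4e9feea439fbefef9be3f4efeeed0234e5e9ebea68efefee529abe346e8fe68fef4e6e8feee346e89afbefabefee689afbefabefeeba8f9feef4e6e8af9befeeeee),
    (1133, 0xbc735e406e892fadeffeed2168afeeaf89feefa9e618fef8ef168feff6e892faefee2fa90d168efeef168edefee6f80defeffda92618f4e05efff8045fe5ef5eff045168feff6e8feee168f4e05effff1205e46e89feef4e56f89efff68f4e05eff89045fe5ef5efff56f8904feefff46e825e90f1aefee905afeaefeafee250e1a6f89effe6f89efff9a618e05effe05e8fee50e6f8eff056e8afeeff806942f5f3adeffaedef3fa215defff5dfeefff35d4926f1aefe6aefef12aefee2fa46f9ef69efef2fa9e6f4dfeef9256f4aedefd1aefeffae4de56fef56fdefff614e50923eadfee3adfeeadefdfee23adfeeadefdfe3a9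deffdfede9aeff2ad03feeffd039aeffee9a03feeffa50f342f9deffde2f9ef2f9ef2f903defeef42d30e5effe3df0e5ef9d05feeff523e0dfef30dfedefff350f24fd1aefef49adefffde9aeff2f9a04deffeff2f9a054fdfeee4d05feefffd46e8730e5e921afefaefe2ea905feefe2e9053afefee3af0e5effe753e02ea86e9ef1e9fee21a68fe89effe6f89eff9ae618fef8ef168feff0e21a68fefefa9e618fef38eff168feff2e9053a68fefe6e8afe1aefeee6e3508afee1aefee8af05feee2e3e6e8a47e905feef9e057efffee0c549e73ed12a68fefe68feff2e6e8afee68f1eaf23edfe3dfeff3ea9ed7e26e8fe168feff2e871fe6efe2e6e7ed89ef19feee6e8a2e9e347edfee4f7deff3e4d21e79fee7e9efeee2e6e89e7a4d35effede35effe3a54dfeefeaf4dfeee13e7de246e89a5ceffeeee4e568eaecfeeeee),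
    (1069, 0x35f476f89bfcf02fafdef1df2aefafef2fa0bfcdfefbcdfedeffff0bfd2a69c18fefefcf89fe9effac69e18fef8f9efe69c18fefefcf89fe9eff2ad69ef89bfcfebecef9efff9d6e8cfaebfeefa6def8cfbedefdeffcfb0f2f6f89fa7dfeeff17d26809aeffafeff06f8fafeffff5b2f6f89cfdf40f7fafe170aefafeffff4760f1f8fcdf2aef9afeef89cafdf02fe1f2ef01fd2eafefffffcfd2a07618efe89feeff8f01f67f9fef16f7eff079af618efe8fe618efe8afeefff0bd64f1782aef9acefeeff27e8fafe79acefeef74289acfeffff89f21aefeafe21aefe9acefeeff67d1c482f9aeffe28aeff8e9aeffe4c2f9aeffece28aeff8e9aeff281a4cefcfef4aecefcfef841ce9aeffec9aeffe9a14ecfeeff2c8f41aedeffd1aefafefae1def8e4defdfec9ae4de18fef18fdeff18f4eadefffec9278f4df1aefed1aefeff847adfefffae47dfedef7deff74df12aefeed21aefe8afeeff4d78912afeaef2aefeeee12a789effef78e9aeffee2d7189fafeeaef89fee1a89feef89fee897adfedefaefee861a47becde2f9efeee2bdefcd47feef47defee47debcefcfeeeea29cf4b17dfeffebf7dfee147b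ecdefeeee4c7df9befefecf7dfee9b4cf271defdfef7dfedeffc4712defdfe2dfefffd7124fe4ef4efe2147eff47feee21d47befeefe4c71bedefedfeee127a46ebecdefeed46ebecfeefaedebfc46effe7aede6bf4ecfe4bcefcfeee46aecede27fbfe7bfeeee),
    (2111, 0x1c7025bfa6f4893defdfeff3def89defdfedfe3f4fd8e6f9efff56abf3489defff89edef9deff894dfedeffffda8ebf349efe4f9ef9bf348efe4f8eff3abf489eff8e9eff4f9a8bfebeffbfe9a483bf6dfedef6dfeffbfd68efefffd43568b2f9aeffefb289aefff89eaef9aeffe6f829aeff9eabfeff52afbf68ef89fee6f8aefff2a68e359bfefffe5bf368efe6f89efff68e35b9aeffeffeb2fa489356fe6ef6efff56389efff8e39effff5683e24eafe4afeff3e2a489fee89effe4af89fee89eaeff43682e9afeef289feeaf89fee2af68ef89feeff56fad203f4f8f9eff8effff46f8957d0bf23faef3aefafe2bf3aefafe3aebfeff0f2ab3defeffff0f2f7abf35defdfedfefff09adb3f56f278ef8fe78feff725f83fe6fe5368efe6f8effffff52a3d7bf68efeb68efeff6f897bdfedefbdefffffd638b97aefafef7efff73ba8e9effe8ae9bfe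fffff678a4d352ce0fbfee02bcefcfe9bcfeeeee0cefbcef235cefcfecfe9ec35effed0ce5b23fe3e9feebe2f9efe5c03e2bef9bfebefeb0f32f9efeee2bfd504f3cefcfe34cefeff0f4cef35cefcfecfe4d35ce0fbfe0bcefcfeee0c35fbfeefbc35feef35cefcfecfe0dce53bfeebef3bf59ceffcfe5bcefcfee35bcedefeeeb2f9a30d45fcef5cefcfef4c5defdfef5cedefcfdfedf4c05feef05cefcfecfeff4cd302f5fafe529aeffeff25fa03feef9a035feef5fe5fef5329a0cdeffcedefff0caedeffcedefcfdf02f9aeff2aefecfdf2a03feefed4823ae05fbfcfe5bfcfeeeef03a8e52bfcfe9beceffbec2e9fef2f58becef9fbfcfe8bfcfebecef285b9fec9feaefaeff8e59afbecefff82aebf35cefcfecfe35bce9aeffeee35b9a2cfeeffc29aeffefffa8e4f50b2f3f9efc2f3f9efe3b2f9cfefc2f9efeee20fbfcf35f48efe48efe305fbf48cfecefcfe485bfcfeef58ebfcfee8e4f05bfcfeeea47d253ce089bfeffb89effee0b3ce89effe893ceffe3cfeeeec0e253e89bfebefbefbe389efff8e9ebe35eff82905bfee35bfebefff0359bfef9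befbfe95beffeb359ef9fe9fee0fbf235feeeece5bd302789effee7e289ef9fe8e9efe70289eff389eff89fe9ef2389eff89feeeee07bed289eff8e9efeee0247895bfc3defdfefd3bfcfebeffffd35fbfcf89fee895beceffeefd7bfc53e89efff3f589fee89eff3f59fbecefffd48937e5becefbfcfe5e7fee37ce5fbfeee7ce538ebfeebe89eff35becefbfcf89fee958becefbfcfe8bfcfeee3bfc75948efef489feeff5f478efe89fee84e579bcfecefbecfe9fe9bfcfee74cef5bcefcfeee24d35bf7ce89eff89cefcfecfe7f89bfcfeee7589bcfeceffffe89537bfceffce7bfebeff7bfceffbf7cefcf35feebf753cedef89cedeffffc5d3e89effff8f35fee3d5bce478ef89fee7e89effee45b897cefeff7ce89effc89effe78be9ceffbcefcfeee7de8b594cfecefee459cefffe4bcefcfeee),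
    (1645, 0x94b06253e7eadfeefad37c158fe8eff5efff53e718cfee8fcfeff53e7edfef587cfa123edfe3dfeff3ed12effef23e7eadfee3ad7cfefee7a1cfdfefeafdfeffc703f5d21a68ef8fef6e8feaf618efe8fefff268053eadfeeff1f053aefadfedefaf3defdfeaf35defdfedfe058f3eadfeeff05368adfee1fadfedef8fadfeeafdf618efe8fefff05368fcf1b2e7eadfeefaf2bef7befbdfedeff1c2faf7bfdf68ef8fe68defff6b28f7eadfee78adeffadfeeaf8defdfeff7fd86afbeceff26abecefbfcfebecefff7cfd21f3bf68afee8fafef618afbfeff3abefffff1afcfd23f678bfefff356f7f8fbefffff862b7ed30e45eafe1e5cefea4f05feeeea7c5d340e1effe4e013efe1e3fee4e015edfee351edfedefdefcd30e45ef5fe4f05feee04d35effee354dfeeffea30d475cfebcfeceff5cf7befbfe7fbecefbec745ef5fee5e147efff45bd7cfefedf71ecfecef17bcfdfefff15bcf7dfedeffff17dfbcf4e05eff450cfecefffff47ed35e0becefffe57be1c3dfe0defee3cf0edfeed03ebfcfe3b1cefecfeeee7bcf4a12d30e5effe3df0e5efffd30e5e12eff12effed0a3215eff5fef53e12effff5a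102e3ef23efff0e3e12efff40d35cfa12effe2ce1afefafcef12af5cfeeffcfa123e5ef35efffecf53fd21aefeafe1f2aefed2eafe1f2aefec01f23f5dfefffd1af02f5fe235feeff0f253f1aefeeaf35fee0fbfcf253fa4dfee1defe4adfeeeaf345defdfe5fe4dfeea20d47e35ebec16feeff531e7becfee7ebf16cefcfecfe1ce67e3beff7befeee735be14ecdfee4cdfeecfdfeeebd435effce1635effe35feee35d4c16feef16cefcfecfeec4df16feeefc4df16feeefd07b3c16eff4e5e16efff435c16effec16feeff6315cfecef5fcfef15fcfef34f5bf16cefcfecfe6fbeceff35b47c16effef1cf67ef7feffffb30e54e16e7cfef7cfef716e4cfef46cfefff716ecf4e05eff6cf4e05effff0376e45e1cfef5cfecef5ec146feeef14576ecfeff657cfecef7cefff5746cfefcefff7c14635effe635feeff354e16effff35c146fe6ef4effff756ebec14ed203efe3fee2e340edfefeeed42e35e0bec16feefff530e21ece6befbfe6ebecfe2e0bfcf16fee16bceffee12e6bce03eff03cefffeee),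
    (333, 0x8cf60fbf74d35f12aefee12aefeefdf29a35feeff35fee24d359aeffee9a35feeff9a35feeff354deffee12f479adf035fbfe5bfeeb35feeffffffb4f59d012f3f67acefffff1f236f7fafcfefffff0fc1647d2a35feef35feef2d359aeffee9a35feeff35defee7fda35fee2f935feeffff7d42a35fee1f6f35fee35fee162a35feef35feefff29a35d4e16efffeed435fee1635feefffd435fee1635feefff35d4e16efffee),
    (461, 0x46f8095bf71f23facdfefffcf23ed1afefedf3eafe7f2d3bece1afef1afefedfa3beceffef37f9d12af5bfcfebecefff5cfb2faefeceb2eafefabf25cfdeffdf5cfeceff9af75bd21ceffcfefff12df5bfcfebecefffff70f6f8fbfcf53fdf12aefee12adfe3defedfedfed205bfcf683e1afeff3e1a89effe89eff683bece1afef1afeff3bece1a89effe89eff1a89becefffe89becefff1af53bfcf68efe68beceff89bfcfeebecef68beceff8ebecefff50bfc2f3f9a68ef8feff68efe3cfb2fa689eff8e9eff68efe6812aebfcfeeef89cfb2faefe21aebfcfeeacfee12aebfcfeee68efe)]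

theorem certifies_tablesOne : ineqOne.Certifies tablesOne = true := by
  -- The trees are expanded to numerals before the test uses them.
  rw [← forceList_eq tablesOne ineqOne.Certifies]
  decide +kernel

theorem certifies_tablesTwo : ineqTwo.Certifies tablesTwo = true := by
  rw [← forceList_eq tablesTwo ineqTwo.Certifies]
  decide +kernel

end SixParty

theorem mainTheorem8 :
    (EntropyInequality.ValidOnGraphs.{u} SixParty.ineqOne ∧
      EntropyInequality.ValidOnGraphs.{u} SixParty.ineqTwo) ∧
    (∃ f, SixParty.ineqOne.IsContractionMap f) ∧
    (∃ f, SixParty.ineqTwo.IsContractionMap f) := by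
  have h₁ := EntropyInequality.isContractionMap_of_certifies SixParty.certifies_tablesOne
  have h₂ := EntropyInequality.isContractionMap_of_certifies SixParty.certifies_tablesTwo
  exact ⟨⟨h₁.validOnGraphs, h₂.validOnGraphs⟩, ⟨_, h₁⟩, ⟨_, h₂⟩⟩
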